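/- Let $N\in\mathbb{N}$ and let $\gamma=(2\pi)^{-N/2}e^{-|x|^2/2}\,dx$ be the standard Gaussian measure on $\mathbb{R}^N$. For $t>0$ let $$M_t(x,y)=\frac{1}{(1-e^{-2t})^{N/2}}\exp\left(-\frac{e^{-2t}|x|^2-2e^{-t}x\cdot y+e^{-2t}|y|^2}{2(1-e^{-2t})}\right)$$ be the Mehler kernel, for $\sigma>0$ let $K_\sigma(x,y)=\int_0^\infty M_t(x,y)\,t^{-\sigma/2-1}\,dt\in[0,\infty]$, and for $s\in(0,1)$ and measurable $u:\mathbb{R}^N\to\mathbb{R}$ let $$[u]_{H^s_\gamma}=\left(\int_{\mathbb{R}^N}\int_{\mathbb{R}^N}|u(x)-u(y)|^2K_{2s}(x,y)\,d\gamma(y)\,d\gamma(x)\right)^{1/2}\in[0,\infty],$$ with the convention $0\cdot\infty=0$. Let $H^s_\gamma(\mathbb{R}^N)$ be the space of all real-valued $u\in L^2_\gamma(\mathbb{R}^N)$ with $[u]_{H^s_\gamma}<\infty$. **Theorem (Maz'ya–Shaposhnikova approximation in $H^s_\gamma$).** Let $s_0\in(0,1)$ and $u\in H^{s_0}_\gamma(\mathbb{R}^N)$.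 Then $[u]_{H^s_\gamma}<\infty$ for every $s\in(0,s_0)$, and $$\lim_{s\to0^+}s\,[u]^2_{H^s_\gamma}=2\left(\|u\|^2_{L^2_\gamma}-\left|\int_{\mathbb{R}^N}u\,d\gamma\right|^2\right).$$ -/

import Mathlib

open MeasureTheory Set Filter Topology
open scoped ENNReal

noncomputable section

/-- The standard Gaussian measure `γ` on `ℝ^N`, with density `(2π)^(-N/2) exp (-|x|²/2)` with
respect to the Lebesgue measure. -/
def gaussMeasure (N : ℕ) : Measure (EuclideanSpace ℝ (Fin N)) :=
  volume.withDensity fun x =>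
    ENNReal.ofReal (1 / (2 * Real.pi) ^ ((N : ℝ) / 2) * Real.exp (-‖x‖ ^ 2 / 2))

/-- The Mehler kernel `M_t(x,y)` (used for `t > 0`). -/
def mehlerKernel (N : ℕ) (t : ℝ) (x y : EuclideanSpace ℝ (Fin N)) : ℝ :=
  1 / (1 - Real.exp (-2 * t)) ^ ((N : ℝ) / 2) *
    Real.exp (-(Real.exp (-2 * t) * ‖x‖ ^ 2 - 2 * Real.exp (-t) * inner ℝ x y
      + Real.exp (-2 * t) * ‖y‖ ^ 2) / (2 * (1 - Real.exp (-2 * t))))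

/-- The kernel `K_σ(x,y) = ∫₀^∞ M_t(x,y) / t^(σ/2+1) dt`, with values in `[0,∞]` (the integrand is
nonnegative). -/
def fracKernel (N : ℕ) (σ : ℝ) (x y : EuclideanSpace ℝ (Fin N)) : ℝ≥0∞ :=
  ∫⁻ t in Ioi (0 : ℝ), ENNReal.ofReal (mehlerKernel N t x y / t ^ (σ / 2 + 1))

/-- The seminorm `[u]_{W^{s,p}_γ(ℝ^N)}`, with values in `[0,∞]`. -/
def gaussFracSeminorm {N : ℕ} (s p : ℝ) (u : EuclideanSpace ℝ (Fin N) → ℝ) : ℝ≥0∞ :=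
  (∫⁻ x, ∫⁻ y, ENNReal.ofReal (|u x - u y| ^ p) * fracKernel N (s * p) x y
    ∂(gaussMeasure N) ∂(gaussMeasure N)) ^ (1 / p)

/-- `u` belongs to the fractional Gaussian Sobolev space `W^{s,p}_γ(ℝ^N)`
(for `0 < s < 1` and `1 ≤ p < ∞`). -/
def MemGaussFracSobolev {N : ℕ} (s p : ℝ) (u : EuclideanSpace ℝ (Fin N) → ℝ) : Prop :=
  MemLp u (ENNReal.ofReal p) (gaussMeasure N) ∧ gaussFracSeminorm s p u < ∞

/-- The seminorm `[u]_{H^s_γ(ℝ^N)}`, where `H^s_γ = W^{s,2}_γ`. -/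
abbrev gaussHSeminorm {N : ℕ} (s : ℝ) (u : EuclideanSpace ℝ (Fin N) → ℝ) : ℝ≥0∞ :=
  gaussFracSeminorm s 2 u

/-- `u ∈ H^s_γ(ℝ^N) = W^{s,2}_γ(ℝ^N)`. -/
abbrev MemGaussH {N : ℕ} (s : ℝ) (u : EuclideanSpace ℝ (Fin N) → ℝ) : Prop :=
  MemGaussFracSobolev s 2 u

end

/-! By Tonelli, the squared seminorm is `∫₀^∞ t^(-s-1) G(t) dt`, where `G(t)` is the Mehler energy,
the double integral of `(u x - u y)² M_t(x,y)` against `γ ⊗ γ`. On `(1,∞)` the weight `s t^(-s-1)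
dt` is a probability measure whose mass escapes to infinity as `s → 0⁺`; on `(0,1]` the integral is
bounded by the finite one for `s₀`, and the factor `s` kills it. So if `G` is bounded and converges,
the limit is `G(∞)` (`tendsto_ofReal_mul_lintegral_rpow`).

As `M_t → 1` pointwise, `G(∞)` should be the double integral of `(u x - u y)²`, twice the variance
of `u`. No dominating function is needed: `M_t` is symmetric with unit marginals, so `G` and its
companion with `(u x + u y)²` add up to the constant `4‖u‖²`. This bounds `G`, and Fatou applied to
both terms leaves neither room to exceed its limit (`tendsto_lintegral_sq_sub_mul`). -/

/-- The substitution `t = exp (τ / s)` in a power-weighted tail integral. -/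
lemma ofReal_mul_lintegral_Ioi_one_rpow (G : ℝ → ℝ≥0∞) {s : ℝ} (hs : 0 < s) :
    ENNReal.ofReal s * ∫⁻ t in Ioi (1 : ℝ), ENNReal.ofReal (t ^ (-(s + 1))) * G t
      = ∫⁻ τ in Ioi (0 : ℝ), ENNReal.ofReal (Real.exp (-τ)) * G (Real.exp (τ / s)) := by
  have him : (fun τ : ℝ => Real.exp (τ / s)) '' Ioi 0 = Ioi 1 := by
    ext t
    simp only [mem_image, mem_Ioi]
    constructor
    · rintro ⟨τ, hτ, rfl⟩
      exact Real.one_lt_exp_iff.2 (div_pos hτ hs)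
    · intro ht
      refine ⟨s * Real.log t, mul_pos hs (Real.log_pos ht), ?_⟩
      rw [mul_div_cancel_left₀ _ hs.ne', Real.exp_log (by linarith)]
  have hd : ∀ τ ∈ Ioi (0 : ℝ), HasDerivWithinAt (fun τ : ℝ => Real.exp (τ / s))
      (Real.exp (τ / s) * (1 / s)) (Ioi 0) τ := fun τ _ =>
    (((hasDerivAt_id τ).div_const s).exp).hasDerivWithinAt
  have hinj : InjOn (fun τ : ℝ => Real.exp (τ / s)) (Ioi 0) := by
    intro a _ b _ h
    have := Real.exp_injective h
    field_simp at this
    exact this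
  rw [← him, lintegral_image_eq_lintegral_abs_deriv_mul measurableSet_Ioi hd hinj,
    ← lintegral_const_mul' _ _ ENNReal.ofReal_ne_top]
  refine lintegral_congr fun τ => ?_
  rw [← mul_assoc, ← mul_assoc, ← ENNReal.ofReal_mul hs.le, ← ENNReal.ofReal_mul (by positivity)]
  congr 2
  rw [abs_of_pos (by positivity), ← Real.exp_mul]
  have : Real.exp (-τ) = Real.exp (τ / s) * Real.exp (τ / s * -(s + 1)) := by
    rw [← Real.exp_add]
    congr 1
    field_simp
    ring
  rw [this]
  field_simp

lemma lintegral_Ioi_zero_exp_neg :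
    ∫⁻ τ in Ioi (0 : ℝ), ENNReal.ofReal (Real.exp (-τ)) = 1 := by
  rw [← ofReal_integral_eq_lintegral_ofReal (integrableOn_exp_neg_Ioi 0)
    (ae_of_all _ fun τ => (Real.exp_pos _).le), integral_exp_neg_Ioi_zero, ENNReal.ofReal_one]

lemma lintegral_Ioc_rpow_mul_le (G : ℝ → ℝ≥0∞) {s s₀ : ℝ} (h : s ≤ s₀) :
    ∫⁻ t in Ioc (0 : ℝ) 1, ENNReal.ofReal (t ^ (-(s + 1))) * G t
      ≤ ∫⁻ t in Ioi (0 : ℝ), ENNReal.ofReal (t ^ (-(s₀ + 1))) * G t := by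
  refine (setLIntegral_mono' measurableSet_Ioc fun t ht => ?_).trans
    (lintegral_mono_set Ioc_subset_Ioi_self)
  gcongr ENNReal.ofReal ?_ * _
  exact Real.rpow_le_rpow_of_exponent_ge ht.1 ht.2 (by linarith)

lemma lintegral_Ioi_zero_split (f : ℝ → ℝ≥0∞) :
    ∫⁻ t in Ioi (0 : ℝ), f t = (∫⁻ t in Ioc (0 : ℝ) 1, f t) + ∫⁻ t in Ioi (1 : ℝ), f t := by
  rw [← lintegral_union measurableSet_Ioi Ioc_disjoint_Ioi_same, Ioc_union_Ioi_eq_Ioi zero_le_one]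

/-- On `(0,1]` lowering the exponent lowers the weight; on `(1,∞)` the weight has finite mass for `s
> 0` and `G` is bounded. -/
lemma lintegral_rpow_mul_lt_top {G : ℝ → ℝ≥0∞} {C : ℝ≥0∞} (hC : C ≠ ∞)
    (hGC : ∀ t > 0, G t ≤ C) {s s₀ : ℝ} (hs : 0 < s) (hss₀ : s ≤ s₀)
    (h : ∫⁻ t in Ioi (0 : ℝ), ENNReal.ofReal (t ^ (-(s₀ + 1))) * G t < ∞) :
    ∫⁻ t in Ioi (0 : ℝ), ENNReal.ofReal (t ^ (-(s + 1))) * G t < ∞ := by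
  rw [lintegral_Ioi_zero_split]
  refine ENNReal.add_lt_top.2 ⟨(lintegral_Ioc_rpow_mul_le G hss₀).trans_lt h, ?_⟩
  have hle : ENNReal.ofReal s * ∫⁻ t in Ioi (1 : ℝ), ENNReal.ofReal (t ^ (-(s + 1))) * G t ≤ C := by
    rw [ofReal_mul_lintegral_Ioi_one_rpow G hs]
    calc _ ≤ ∫⁻ τ in Ioi (0 : ℝ), ENNReal.ofReal (Real.exp (-τ)) * C := by
          gcongr with τ
          exact hGC _ (Real.exp_pos _)
      _ = C := by
          rw [lintegral_mul_const' _ _ hC, lintegral_Ioi_zero_exp_neg, one_mul]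
  by_contra htop
  rw [not_lt, top_le_iff] at htop
  rw [htop, ENNReal.mul_top (by simpa using hs)] at hle
  exact hC (top_le_iff.1 hle)

/-- An Abelian theorem: `s ∫₀^∞ t^(-s-1) G(t) dt → G(∞)` as `s → 0⁺`. -/
lemma tendsto_ofReal_mul_lintegral_rpow {G : ℝ → ℝ≥0∞} (hG : Measurable G) {C L : ℝ≥0∞}
    (hC : C ≠ ∞) (hGC : ∀ t > 0, G t ≤ C) (hL : Tendsto G atTop (𝓝 L)) {s₀ : ℝ} (hs₀ : 0 < s₀)
    (h : ∫⁻ t in Ioi (0 : ℝ), ENNReal.ofReal (t ^ (-(s₀ + 1))) * G t < ∞) :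
    Tendsto (fun s : ℝ => ENNReal.ofReal s *
      ∫⁻ t in Ioi (0 : ℝ), ENNReal.ofReal (t ^ (-(s + 1))) * G t) (𝓝[>] 0) (𝓝 L) := by
  have hnear : Tendsto (fun s : ℝ => ENNReal.ofReal s *
      ∫⁻ t in Ioc (0 : ℝ) 1, ENNReal.ofReal (t ^ (-(s + 1))) * G t) (𝓝[>] 0) (𝓝 0) := by
    have hz : Tendsto (fun s : ℝ => ENNReal.ofReal s *
        ∫⁻ t in Ioi (0 : ℝ), ENNReal.ofReal (t ^ (-(s₀ + 1))) * G t) (𝓝[>] 0) (𝓝 0) := by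
      have h1 : Tendsto (fun s : ℝ => ENNReal.ofReal s) (𝓝[>] 0) (𝓝 0) := by
        have := ENNReal.continuous_ofReal.tendsto (0 : ℝ)
        rw [ENNReal.ofReal_zero] at this
        exact this.mono_left nhdsWithin_le_nhds
      simpa using ENNReal.Tendsto.mul_const h1 (Or.inr h.ne)
    refine tendsto_of_tendsto_of_tendsto_of_le_of_le' tendsto_const_nhds hz
      (Eventually.of_forall fun _ => zero_le) ?_
    filter_upwards [Ioo_mem_nhdsGT hs₀] with s hs
    refine mul_le_mul_right ?_ _
    exact lintegral_Ioc_rpow_mul_le G hs.2.le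
  have hfar : Tendsto (fun s : ℝ => ENNReal.ofReal s *
      ∫⁻ t in Ioi (1 : ℝ), ENNReal.ofReal (t ^ (-(s + 1))) * G t) (𝓝[>] 0) (𝓝 L) := by
    have hlim : Tendsto (fun s : ℝ =>
        ∫⁻ τ in Ioi (0 : ℝ), ENNReal.ofReal (Real.exp (-τ)) * G (Real.exp (τ / s))) (𝓝[>] 0)
        (𝓝 (∫⁻ τ in Ioi (0 : ℝ), ENNReal.ofReal (Real.exp (-τ)) * L)) := by
      refine tendsto_lintegral_filter_of_dominated_convergence
        (fun τ => ENNReal.ofReal (Real.exp (-τ)) * C) ?_ ?_ ?_ ?_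
      · exact Eventually.of_forall fun s => by fun_prop
      · exact Eventually.of_forall fun s => ae_of_all _ fun τ => by
          gcongr
          exact hGC _ (Real.exp_pos _)
      · rw [lintegral_mul_const' _ _ hC, lintegral_Ioi_zero_exp_neg, one_mul]
        exact hC
      · filter_upwards [ae_restrict_mem measurableSet_Ioi] with τ hτ
        -- For fixed `τ > 0`, the argument `exp (τ / s)` tends to infinity as `s → 0⁺`.
        refine ENNReal.Tendsto.const_mul (hL.comp (Real.tendsto_exp_atTop.comp ?_))
          (Or.inr ENNReal.ofReal_ne_top)
        exact (tendsto_inv_nhdsGT_zero.const_mul_atTop hτ).congr fun s => (div_eq_mul_inv τ s).symm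
    have hLC : L ≠ ∞ := ne_top_of_le_ne_top hC <|
      le_of_tendsto hL ((eventually_gt_atTop 0).mono hGC)
    rw [lintegral_mul_const' _ _ hLC, lintegral_Ioi_zero_exp_neg, one_mul] at hlim
    refine hlim.congr' ?_
    filter_upwards [self_mem_nhdsWithin] with s hs
    exact (ofReal_mul_lintegral_Ioi_one_rpow G hs).symm
  have hsum := hnear.add hfar
  simp only [zero_add] at hsum
  refine hsum.congr fun s => ?_
  rw [lintegral_Ioi_zero_split, mul_add]

/-! ### Gaussian measure and Mehler kernel -/

lemma lintegral_ofReal_exp_neg_mul_sq_norm (N : ℕ) {b : ℝ} (hb : 0 < b) :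
    ∫⁻ v : EuclideanSpace ℝ (Fin N), ENNReal.ofReal (Real.exp (-b * ‖v‖ ^ 2))
      = ENNReal.ofReal ((Real.pi / b) ^ ((N : ℝ) / 2)) := by
  have hI := GaussianFourier.integral_rexp_neg_mul_sq_norm (V := EuclideanSpace ℝ (Fin N)) hb
  rw [finrank_euclideanSpace_fin] at hI
  have hpos : 0 < (Real.pi / b) ^ ((N : ℝ) / 2) := Real.rpow_pos_of_pos (by positivity) _
  -- The Bochner integral of a non-integrable function is 0, so a nonzero value proves
  -- integrability.
  have hint : Integrable fun v : EuclideanSpace ℝ (Fin N) => Real.exp (-b * ‖v‖ ^ 2) :=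
    Integrable.of_integral_ne_zero (by rw [hI]; exact hpos.ne')
  rw [← ofReal_integral_eq_lintegral_ofReal hint (ae_of_all _ fun v => (Real.exp_pos _).le), hI]

/-- Every shifted Gaussian, normalised, has total mass one. -/
lemma lintegral_ofReal_shifted_gaussian (N : ℕ) {b : ℝ} (hb : 0 < b)
    (a : EuclideanSpace ℝ (Fin N)) :
    ∫⁻ v : EuclideanSpace ℝ (Fin N),
      ENNReal.ofReal ((b / Real.pi) ^ ((N : ℝ) / 2) * Real.exp (-b * ‖v - a‖ ^ 2)) = 1 := by
  have hp : 0 ≤ b / Real.pi := by positivity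
  simp_rw [ENNReal.ofReal_mul (Real.rpow_nonneg hp _)]
  rw [lintegral_const_mul' _ _ ENNReal.ofReal_ne_top,
    lintegral_sub_right_eq_self (fun v => ENNReal.ofReal (Real.exp (-b * ‖v‖ ^ 2))) a,
    lintegral_ofReal_exp_neg_mul_sq_norm N hb, ← ENNReal.ofReal_mul (Real.rpow_nonneg hp _),
    ← Real.mul_rpow hp (by positivity)]
  have : b / Real.pi * (Real.pi / b) = 1 := by
    have := Real.pi_ne_zero
    field_simp
  rw [this, Real.one_rpow, ENNReal.ofReal_one]

instance isProbabilityMeasure_gaussMeasure (N : ℕ) : IsProbabilityMeasure (gaussMeasure N) := by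
  constructor
  rw [gaussMeasure, withDensity_apply _ MeasurableSet.univ, Measure.restrict_univ,
    ← lintegral_ofReal_shifted_gaussian N (b := 1 / 2) (by norm_num) 0]
  refine lintegral_congr fun v => ?_
  rw [sub_zero]
  congr 2
  · rw [one_div, ← Real.inv_rpow (by positivity)]
    congr 1
    field_simp
  · congr 1
    ring

lemma measurable_mehlerKernel (N : ℕ) : Measurable
    fun p : ℝ × (EuclideanSpace ℝ (Fin N) × EuclideanSpace ℝ (Fin N)) =>
      mehlerKernel N p.1 p.2.1 p.2.2 := by
  unfold mehlerKernel
  fun_prop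

lemma mehlerKernel_comm (N : ℕ) (t : ℝ) (x y : EuclideanSpace ℝ (Fin N)) :
    mehlerKernel N t x y = mehlerKernel N t y x := by
  unfold mehlerKernel
  rw [real_inner_comm]
  congr 4
  ring

/-- The Mehler semigroup preserves constants. -/
lemma lintegral_mehlerKernel (N : ℕ) {t : ℝ} (ht : 0 < t) (x : EuclideanSpace ℝ (Fin N)) :
    ∫⁻ y, ENNReal.ofReal (mehlerKernel N t x y) ∂(gaussMeasure N) = 1 := by
  have hm : Measurable fun y => ENNReal.ofReal (mehlerKernel N t x y) :=
    ((measurable_mehlerKernel N).comp (by fun_prop :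
      Measurable fun y : EuclideanSpace ℝ (Fin N) => (t, (x, y)))).ennreal_ofReal
  have hq : Real.exp (-2 * t) = Real.exp (-t) ^ 2 := by
    rw [← Real.exp_nat_mul]
    congr 1
    push_cast
    ring
  have hlt : Real.exp (-2 * t) < 1 := Real.exp_lt_one_iff.2 (by linarith)
  have hd : 0 < 1 - Real.exp (-2 * t) := by linarith
  have hpi := Real.pi_pos
  -- Completing the square, `M_t(x,·) dγ` is the Gaussian law with mean `e^(-t) x` and covariance
  -- `(1 - e^(-2t)) I`.
  rw [gaussMeasure, lintegral_withDensity_eq_lintegral_mul _ (by fun_prop) hm,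
    ← lintegral_ofReal_shifted_gaussian N (b := 1 / (2 * (1 - Real.exp (-2 * t)))) (by positivity)
      (Real.exp (-t) • x)]
  refine lintegral_congr fun y => ?_
  rw [Pi.mul_apply, ← ENNReal.ofReal_mul (by positivity)]
  congr 1
  have hc : (1 / (2 * (1 - Real.exp (-2 * t))) / Real.pi) ^ ((N : ℝ) / 2)
      = 1 / (2 * Real.pi) ^ ((N : ℝ) / 2) * (1 / (1 - Real.exp (-2 * t)) ^ ((N : ℝ) / 2)) := by
    rw [one_div_mul_one_div, ← Real.mul_rpow (by positivity) hd.le, one_div (_ ^ _),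
      ← Real.inv_rpow (by positivity)]
    congr 1
    field_simp
  have he : Real.exp (-(1 / (2 * (1 - Real.exp (-2 * t)))) * ‖y - Real.exp (-t) • x‖ ^ 2)
      = Real.exp (-‖y‖ ^ 2 / 2) * Real.exp (-(Real.exp (-2 * t) * ‖x‖ ^ 2
        - 2 * Real.exp (-t) * inner ℝ x y + Real.exp (-2 * t) * ‖y‖ ^ 2)
          / (2 * (1 - Real.exp (-2 * t)))) := by
    rw [← Real.exp_add, norm_sub_sq_real, inner_smul_right, norm_smul, Real.norm_eq_abs,
      abs_of_pos (Real.exp_pos _), real_inner_comm, mul_pow, ← hq]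
    congr 1
    have hd' := hd.ne'
    generalize Real.exp (-2 * t) = q at hd' ⊢
    field_simp
    ring
  rw [hc, he, mehlerKernel]
  ring

/-- The Mehler kernel converges to one as `t → ∞`. -/
lemma tendsto_mehlerKernel (N : ℕ) (x y : EuclideanSpace ℝ (Fin N)) :
    Tendsto (fun t => mehlerKernel N t x y) atTop (𝓝 1) := by
  have h1 : Tendsto (fun t : ℝ => Real.exp (-t)) atTop (𝓝 0) := Real.tendsto_exp_neg_atTop_nhds_zero
  have h2 : Tendsto (fun t : ℝ => Real.exp (-2 * t)) atTop (𝓝 0) :=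
    Real.tendsto_exp_atBot.comp (tendsto_id.const_mul_atTop_of_neg (by norm_num))
  -- `e^(-t)` and `e^(-2t)` become independent variables, both tending to 0.
  have hc : ContinuousAt (fun p : ℝ × ℝ => 1 / (1 - p.2) ^ ((N : ℝ) / 2) *
      Real.exp (-(p.2 * ‖x‖ ^ 2 - 2 * p.1 * inner ℝ x y + p.2 * ‖y‖ ^ 2) / (2 * (1 - p.2))))
      (0, 0) := by
    refine ContinuousAt.mul (ContinuousAt.div continuousAt_const ?_ (by simp)) ?_
    · exact ContinuousAt.rpow_const (by fun_prop) (Or.inl (by simp))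
    · exact (ContinuousAt.div (by fun_prop) (by fun_prop) (by simp)).rexp
  simpa [mehlerKernel, Function.comp_def] using hc.tendsto.comp (h1.prodMk_nhds h2)

/-! ### Energies of doubly stochastic densities -/

section Energy

variable {X : Type*} [MeasurableSpace X] {μ : Measure X}

/-- Parallelogram identity for the energies of a doubly stochastic density. -/
lemma lintegral_sq_sub_add_lintegral_sq_add [SFinite μ] {w : X × X → ℝ≥0∞} (hw : Measurable w)
    (h₁ : ∀ x, ∫⁻ y, w (x, y) ∂μ = 1) (h₂ : ∀ y, ∫⁻ x, w (x, y) ∂μ = 1)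
    {u : X → ℝ} (hu : Measurable u) :
    (∫⁻ z, ENNReal.ofReal ((u z.1 - u z.2) ^ 2) * w z ∂(μ.prod μ))
      + ∫⁻ z, ENNReal.ofReal ((u z.1 + u z.2) ^ 2) * w z ∂(μ.prod μ)
      = 4 * ∫⁻ x, ENNReal.ofReal (u x ^ 2) ∂μ := by
  have hf : ∫⁻ z, ENNReal.ofReal (u z.1 ^ 2) * w z ∂(μ.prod μ)
      = ∫⁻ x, ENNReal.ofReal (u x ^ 2) ∂μ := by
    rw [lintegral_prod _ (by fun_prop)]
    refine lintegral_congr fun x => ?_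
    dsimp only
    rw [lintegral_const_mul' _ _ ENNReal.ofReal_ne_top, h₁, mul_one]
  have hs : ∫⁻ z, ENNReal.ofReal (u z.2 ^ 2) * w z ∂(μ.prod μ)
      = ∫⁻ x, ENNReal.ofReal (u x ^ 2) ∂μ := by
    rw [lintegral_prod_symm _ (by fun_prop)]
    refine lintegral_congr fun x => ?_
    dsimp only
    rw [lintegral_const_mul' _ _ ENNReal.ofReal_ne_top, h₂, mul_one]
  have hpt : ∀ z : X × X, ENNReal.ofReal ((u z.1 - u z.2) ^ 2) * w z
      + ENNReal.ofReal ((u z.1 + u z.2) ^ 2) * w z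
      = 2 * (ENNReal.ofReal (u z.1 ^ 2) * w z) + 2 * (ENNReal.ofReal (u z.2 ^ 2) * w z) := by
    intro z
    rw [← add_mul, ← mul_add, ← add_mul, ← mul_assoc,
      ← ENNReal.ofReal_add (sq_nonneg _) (sq_nonneg _),
      ← ENNReal.ofReal_add (sq_nonneg _) (sq_nonneg _),
      show (2 : ℝ≥0∞) = ENNReal.ofReal 2 by simp, ← ENNReal.ofReal_mul (by norm_num)]
    congr 2
    ring
  rw [← lintegral_add_left (by fun_prop), lintegral_congr hpt, lintegral_add_left (by fun_prop),
    lintegral_const_mul _ (by fun_prop), lintegral_const_mul _ (by fun_prop), hf, hs, ← add_mul]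
  norm_num

/-- A lower bound on `g` is an upper bound on `f = c - g`: `limsup f = c - liminf g ≤ c - b = a`.
Finiteness of `c` makes the subtractions cancel. -/
lemma ENNReal.tendsto_of_add_eq_of_le_liminf {ι : Type*} {l : Filter ι} {f g : ι → ℝ≥0∞}
    {a b c : ℝ≥0∞} (hc : c ≠ ∞) (hfg : ∀ᶠ i in l, f i + g i = c) (hab : a + b = c)
    (hf : a ≤ liminf f l) (hg : b ≤ liminf g l) : Tendsto f l (𝓝 a) := by
  refine tendsto_of_le_liminf_of_limsup_le hf ?_
  have hb : b ≠ ∞ := ne_top_of_le_ne_top hc (hab ▸ le_add_self)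
  have hlim : limsup f l = limsup (fun i => c - g i) l := by
    refine limsup_congr (hfg.mono fun i hi => ?_)
    have hgi : g i ≠ ∞ := ne_top_of_le_ne_top hc (hi ▸ le_add_self)
    rw [← hi, ENNReal.add_sub_cancel_right hgi]
  rw [hlim, ENNReal.limsup_const_sub _ _ hc]
  refine (tsub_le_tsub_left hg c).trans ?_
  rw [← hab, ENNReal.add_sub_cancel_right hb]

/-- Convergence of energies along doubly stochastic densities that converge to one pointwise. -/
lemma tendsto_lintegral_sq_sub_mul [IsProbabilityMeasure μ] {w : ℝ → X × X → ℝ≥0∞}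
    (hw : ∀ t, Measurable (w t)) (h₁ : ∀ t > 0, ∀ x, ∫⁻ y, w t (x, y) ∂μ = 1)
    (h₂ : ∀ t > 0, ∀ y, ∫⁻ x, w t (x, y) ∂μ = 1)
    (hlim : ∀ z, Tendsto (fun t => w t z) atTop (𝓝 1))
    {u : X → ℝ} (hu : Measurable u) (hfin : ∫⁻ x, ENNReal.ofReal (u x ^ 2) ∂μ ≠ ∞) :
    Tendsto (fun t => ∫⁻ z, ENNReal.ofReal ((u z.1 - u z.2) ^ 2) * w t z ∂(μ.prod μ)) atTop
      (𝓝 (∫⁻ z, ENNReal.ofReal ((u z.1 - u z.2) ^ 2) ∂(μ.prod μ))) := by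
  have hfatou : ∀ v : X × X → ℝ, Measurable v →
      ∫⁻ z, ENNReal.ofReal (v z ^ 2) ∂(μ.prod μ)
        ≤ liminf (fun t => ∫⁻ z, ENNReal.ofReal (v z ^ 2) * w t z ∂(μ.prod μ)) atTop := by
    intro v hv
    have hmeas : ∀ t, AEMeasurable (fun z => ENNReal.ofReal (v z ^ 2) * w t z) (μ.prod μ) :=
      fun t => by
        have := hw t
        fun_prop
    refine le_trans (le_of_eq (lintegral_congr fun z => ?_)) (lintegral_liminf_le' hmeas)
    have h := ENNReal.Tendsto.const_mul (a := ENNReal.ofReal (v z ^ 2)) (hlim z)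
      (Or.inr ENNReal.ofReal_ne_top)
    rw [mul_one] at h
    exact h.liminf_eq.symm
  refine ENNReal.tendsto_of_add_eq_of_le_liminf (ENNReal.mul_ne_top (by norm_num) hfin)
    ((eventually_gt_atTop 0).mono fun t ht =>
      lintegral_sq_sub_add_lintegral_sq_add (hw t) (h₁ t ht) (h₂ t ht) hu)
    ?_ (hfatou _ (by fun_prop)) (hfatou _ (by fun_prop))
  -- The density 1 is itself doubly stochastic, so the limiting energies have the same sum.
  simpa using lintegral_sq_sub_add_lintegral_sq_add (μ := μ) (w := fun _ => 1) measurable_const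
    (by simp) (by simp) hu

lemma toReal_lintegral_sq_sub [IsProbabilityMeasure μ] {u : X → ℝ} (hu : MemLp u 2 μ) :
    (∫⁻ z, ENNReal.ofReal ((u z.1 - u z.2) ^ 2) ∂(μ.prod μ)).toReal
      = 2 * (∫ x, u x ^ 2 ∂μ - (∫ x, u x ∂μ) ^ 2) := by
  have hu1 : Integrable u μ := hu.integrable (by norm_num)
  have hsq : Integrable (fun x => u x ^ 2) μ := hu.integrable_sq
  have hm : AEStronglyMeasurable (fun z : X × X => (u z.1 - u z.2) ^ 2) (μ.prod μ) :=
    (hu.1.comp_fst.sub hu.1.comp_snd).pow 2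
  rw [← integral_eq_lintegral_of_nonneg_ae (ae_of_all _ fun z => sq_nonneg _) hm]
  have hexp : (fun z : X × X => (u z.1 - u z.2) ^ 2)
      = fun z => u z.1 ^ 2 + u z.2 ^ 2 - 2 * (u z.1 * u z.2) := by
    funext z
    ring
  have hadd : Integrable (fun z : X × X => u z.1 ^ 2 + u z.2 ^ 2) (μ.prod μ) :=
    (hsq.comp_fst μ).add (hsq.comp_snd μ)
  rw [hexp, integral_sub hadd ((hu1.mul_prod hu1).const_mul 2),
    integral_add (hsq.comp_fst μ) (hsq.comp_snd μ), integral_const_mul, integral_prod_mul,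
    integral_fun_fst (fun x => u x ^ 2), integral_fun_snd (fun x => u x ^ 2)]
  simp
  ring

lemma lintegral_ofReal_sq_ne_top {u : X → ℝ} (hu : MemLp u 2 μ) :
    ∫⁻ x, ENNReal.ofReal (u x ^ 2) ∂μ ≠ ∞ :=
  hu.integrable_sq.lintegral_lt_top.ne

lemma toReal_eLpNorm_two_sq {u : X → ℝ} (hu : MemLp u 2 μ) :
    (eLpNorm u 2 μ).toReal ^ 2 = ∫ x, u x ^ 2 ∂μ := by
  rw [hu.eLpNorm_eq_integral_rpow_norm (by norm_num) (by norm_num)]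
  have hnn : 0 ≤ ∫ x, u x ^ 2 ∂μ := integral_nonneg fun x => sq_nonneg _
  simp only [ENNReal.toReal_ofNat, Real.rpow_ofNat, Real.norm_eq_abs, sq_abs]
  rw [ENNReal.toReal_ofReal (Real.rpow_nonneg hnn _), ← Real.rpow_mul_natCast hnn]
  norm_num

end Energy

/-! ### Subordination and conclusion -/

lemma gaussFracSeminorm_congr_ae {N : ℕ} {s p : ℝ} {u v : EuclideanSpace ℝ (Fin N) → ℝ}
    (h : u =ᵐ[gaussMeasure N] v) : gaussFracSeminorm s p u = gaussFracSeminorm s p v := by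
  unfold gaussFracSeminorm
  congr 1
  refine lintegral_congr_ae (h.mono fun x hx => ?_)
  refine lintegral_congr_ae (h.mono fun y hy => ?_)
  simp only [hx, hy]

/-- Subordination: the seminorm is a power-weighted integral of the Mehler energies. -/
lemma gaussHSeminorm_eq {N : ℕ} (s : ℝ) {u : EuclideanSpace ℝ (Fin N) → ℝ} (hu : Measurable u) :
    gaussHSeminorm s u = (∫⁻ t in Ioi (0 : ℝ), ENNReal.ofReal (t ^ (-(s + 1))) *
      ∫⁻ z, ENNReal.ofReal ((u z.1 - u z.2) ^ 2) * ENNReal.ofReal (mehlerKernel N t z.1 z.2)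
        ∂((gaussMeasure N).prod (gaussMeasure N))) ^ (1 / 2 : ℝ) := by
  have hM := measurable_mehlerKernel N
  have hJ : Measurable fun q : (EuclideanSpace ℝ (Fin N) × EuclideanSpace ℝ (Fin N)) × ℝ =>
      ENNReal.ofReal (mehlerKernel N q.2 q.1.1 q.1.2 / q.2 ^ (s * 2 / 2 + 1)) :=
    ((hM.comp measurable_swap).div (by fun_prop)).ennreal_ofReal
  have hK : Measurable fun z : EuclideanSpace ℝ (Fin N) × EuclideanSpace ℝ (Fin N) =>
      fracKernel N (s * 2) z.1 z.2 := hJ.lintegral_prod_right'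
  unfold gaussHSeminorm gaussFracSeminorm
  congr 1
  rw [← lintegral_prod (fun z : EuclideanSpace ℝ (Fin N) × EuclideanSpace ℝ (Fin N) =>
    ENNReal.ofReal (|u z.1 - u z.2| ^ (2 : ℝ)) * fracKernel N (s * 2) z.1 z.2) (by fun_prop)]
  simp only [Real.rpow_ofNat, sq_abs, fracKernel]
  simp_rw [← lintegral_const_mul' _ _ ENNReal.ofReal_ne_top]
  rw [lintegral_lintegral_swap (by
    refine Measurable.aemeasurable (Measurable.mul ?_ hJ)
    fun_prop)]
  refine setLIntegral_congr_fun measurableSet_Ioi fun t ht => ?_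
  refine lintegral_congr fun z => ?_
  rw [mul_left_comm, ← ENNReal.ofReal_mul (Real.rpow_nonneg (le_of_lt ht) _),
    Real.rpow_neg (le_of_lt ht), mul_div_cancel_right₀ s two_ne_zero, div_eq_inv_mul]

theorem mainTheorem2 (N : ℕ) (s₀ : ℝ) (hs₀ : s₀ ∈ Ioo (0 : ℝ) 1)
    (u : EuclideanSpace ℝ (Fin N) → ℝ) (hu : MemGaussH s₀ u) :
    (∀ s ∈ Ioo (0 : ℝ) s₀, gaussHSeminorm s u < ∞) ∧
    Tendsto (fun s : ℝ => s * (gaussHSeminorm s u).toReal ^ 2) (𝓝[>] 0)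
      (𝓝 (2 * ((eLpNorm u 2 (gaussMeasure N)).toReal ^ 2
        - |∫ x, u x ∂(gaussMeasure N)| ^ 2))) := by
  obtain ⟨huL, husemi⟩ := hu
  rw [ENNReal.ofReal_ofNat] at huL
  -- `u` is only a.e. strongly measurable; a measurable representative is needed for Tonelli and
  -- changes neither side.
  obtain ⟨v, hvm, huv⟩ := huL.1
  have hv : Measurable v := hvm.measurable
  have hvL : MemLp v 2 (gaussMeasure N) := huL.ae_eq huv
  have hsemi : ∀ s, gaussHSeminorm s u = gaussHSeminorm s v := fun s =>
    gaussFracSeminorm_congr_ae huv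
  rw [eLpNorm_congr_ae huv, integral_congr_ae huv, toReal_eLpNorm_two_sq hvL, sq_abs,
    ← toReal_lintegral_sq_sub hvL]
  replace husemi : gaussHSeminorm s₀ v < ∞ := hsemi s₀ ▸ husemi
  simp only [hsemi]
  clear hsemi
  have hM := measurable_mehlerKernel N
  let G : ℝ → ℝ≥0∞ := fun t => ∫⁻ z, ENNReal.ofReal ((v z.1 - v z.2) ^ 2) *
    ENNReal.ofReal (mehlerKernel N t z.1 z.2) ∂((gaussMeasure N).prod (gaussMeasure N))
  have hrep : ∀ s, gaussHSeminorm s v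
      = (∫⁻ t in Ioi (0 : ℝ), ENNReal.ofReal (t ^ (-(s + 1))) * G t) ^ (1 / 2 : ℝ) :=
    fun s => gaussHSeminorm_eq s hv
  have hG : Measurable G := by
    refine Measurable.lintegral_prod_right'
      (f := fun q : ℝ × (EuclideanSpace ℝ (Fin N) × EuclideanSpace ℝ (Fin N)) =>
        ENNReal.ofReal ((v q.2.1 - v q.2.2) ^ 2) *
          ENNReal.ofReal (mehlerKernel N q.1 q.2.1 q.2.2)) ?_
    exact Measurable.mul (by fun_prop) hM.ennreal_ofReal
  have hw : ∀ t, Measurable fun z : EuclideanSpace ℝ (Fin N) × EuclideanSpace ℝ (Fin N) =>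
      ENNReal.ofReal (mehlerKernel N t z.1 z.2) := fun t =>
    (hM.comp measurable_prodMk_left).ennreal_ofReal
  have h₁ : ∀ t > 0, ∀ x, ∫⁻ y, ENNReal.ofReal (mehlerKernel N t x y) ∂(gaussMeasure N) = 1 :=
    fun t ht x => lintegral_mehlerKernel N ht x
  have h₂ : ∀ t > 0, ∀ y, ∫⁻ x, ENNReal.ofReal (mehlerKernel N t x y) ∂(gaussMeasure N) = 1 :=
    fun t ht y => by
      simp_rw [mehlerKernel_comm N t _ y]
      exact lintegral_mehlerKernel N ht y
  have hfin := lintegral_ofReal_sq_ne_top hvL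
  have hC : 4 * ∫⁻ x, ENNReal.ofReal (v x ^ 2) ∂(gaussMeasure N) ≠ ∞ :=
    ENNReal.mul_ne_top (by norm_num) hfin
  have hGC : ∀ t > 0, G t ≤ 4 * ∫⁻ x, ENNReal.ofReal (v x ^ 2) ∂(gaussMeasure N) := fun t ht => by
    rw [← lintegral_sq_sub_add_lintegral_sq_add (hw t) (h₁ t ht) (h₂ t ht) hv]
    exact le_self_add
  have hL : Tendsto G atTop (𝓝 (∫⁻ z, ENNReal.ofReal ((v z.1 - v z.2) ^ 2)
      ∂((gaussMeasure N).prod (gaussMeasure N)))) :=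
    tendsto_lintegral_sq_sub_mul hw h₁ h₂ (fun z => by
      simpa using ENNReal.tendsto_ofReal (tendsto_mehlerKernel N z.1 z.2)) hv hfin
  have hs₀fin : ∫⁻ t in Ioi (0 : ℝ), ENNReal.ofReal (t ^ (-(s₀ + 1))) * G t < ∞ := by
    rw [hrep] at husemi
    exact (ENNReal.rpow_lt_top_iff_of_pos (by norm_num)).1 husemi
  constructor
  · intro s hs
    rw [hrep]
    exact ENNReal.rpow_lt_top_of_nonneg (by norm_num)
      (lintegral_rpow_mul_lt_top hC hGC hs.1 hs.2.le hs₀fin).ne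
  · have hLfin := ne_top_of_le_ne_top hC (le_of_tendsto hL ((eventually_gt_atTop 0).mono hGC))
    refine ((ENNReal.tendsto_toReal hLfin).comp
      (tendsto_ofReal_mul_lintegral_rpow hG hC hGC hL hs₀.1 hs₀fin)).congr' ?_
    filter_upwards [self_mem_nhdsWithin] with s hs
    rw [Function.comp_apply, ENNReal.toReal_mul, ENNReal.toReal_ofReal (le_of_lt hs), hrep,
      ← ENNReal.toReal_rpow, ← Real.rpow_mul_natCast ENNReal.toReal_nonneg]
    norm_num
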